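/- Let $n\ge 0$ and let $w=w_1w_2\cdots w_n$ be a permutation in the symmetric group $\mathfrak S_n$. Let $O_w\subseteq[n]\times[n]$ be the south-west diagram of $w$, that is, the set of all cells $(i,w_j)$ (row $i$, column $w_j$) with $1\le i<j\le n$ and $w_i<w_j$. Let $\preceq$ be the strong Bruhat order on $\mathfrak S_n$, that is, the partial order whose cover relations are $u\prec u\cdot t$ for $t$ a transposition with $\ell(u\cdot t)=\ell(u)+1$, where $\ell(u)$ denotes the number of inversions of $u$; let $\iota$ be the identity permutation and $[\iota,w]=\{u\in\mathfrak S_n : \iota\preceq u\preceq w\}$. Then the number of placements of $n$ non-attacking rooks on $([n]\times[n])\setminus O_w$ (sets of $n$ cells of this board, no two in the same row or column) equals $\#[\iota,w]$ if and only if $w$ avoids the permutation patterns $4231$, $35142$, $42513$, and $351624$. -/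

import Mathlib

namespace RookBruhat

/-- The south-west diagram `O_w`, with the permutation matrix of `w` having its nonzero entries in
the cells `(i, w i)` (row, column): all cells `(i, w j)` with `i < j` and `w i < w j`. -/
def swDiagram {n : ℕ} (w : Equiv.Perm (Fin n)) : Set (Fin n × Fin n) :=
  {c | ∃ i j : Fin n, i < j ∧ w i < w j ∧ c = (i, w j)}

/-- `R` is a rook placement on the board `B`: a set of cells of `B`, no two of which lie in the
same row or in the same column. -/
def IsRookPlacement {n : ℕ} (B : Set (Fin n × Fin n)) (R : Finset (Fin n × Fin n)) : Prop :=
  (∀ c ∈ R, c ∈ B) ∧ ∀ c ∈ R, ∀ d ∈ R, c ≠ d → c.1 ≠ d.1 ∧ c.2 ≠ d.2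

/-- The number of placements of `n` non-attacking rooks on `([n] × [n]) \ B`. -/
noncomputable def rookPlacementsAvoiding {n : ℕ} (B : Set (Fin n × Fin n)) : ℕ :=
  {R : Finset (Fin n × Fin n) | IsRookPlacement Bᶜ R ∧ R.card = n}.ncard

/-- The number of inversions of `w`. -/
def length {n : ℕ} (w : Equiv.Perm (Fin n)) : ℕ :=
  (Finset.univ.filter fun p : Fin n × Fin n => p.1 < p.2 ∧ w p.2 < w p.1).card

/-- The cover relation of the strong Bruhat order: `v = u * t` for a transposition `t`, and `v` has
exactly one inversion more than `u`. -/
def BruhatCover {n : ℕ} (u v : Equiv.Perm (Fin n)) : Prop :=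
  ∃ i j : Fin n, i ≠ j ∧ v = u * Equiv.swap i j ∧ length v = length u + 1

/-- The strong Bruhat order: the reflexive transitive closure of its cover relation. -/
def BruhatLE {n : ℕ} : Equiv.Perm (Fin n) → Equiv.Perm (Fin n) → Prop :=
  Relation.ReflTransGen BruhatCover

/-- The interval `[u, v]` in the strong Bruhat order. -/
def bruhatInterval {n : ℕ} (u v : Equiv.Perm (Fin n)) : Set (Equiv.Perm (Fin n)) :=
  {x | BruhatLE u x ∧ BruhatLE x v}

/-- `w` contains the pattern with one-line notation `p`: there are positions `f 0 < f 1 < ⋯` at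
which the values of `w` are in the same relative order as the entries of `p`. -/
def ContainsPattern {n k : ℕ} (w : Equiv.Perm (Fin n)) (p : Fin k → ℕ) : Prop :=
  ∃ f : Fin k → Fin n, StrictMono f ∧ ∀ a b : Fin k, w (f a) < w (f b) ↔ p a < p b

/-- `w` avoids the pattern with one-line notation `p`. -/
def AvoidsPattern {n k : ℕ} (w : Equiv.Perm (Fin n)) (p : Fin k → ℕ) : Prop :=
  ¬ ContainsPattern w p

end RookBruhat

namespace RookBruhat

open Equiv

/-! Write `u = w * p`. Rook placements become the `p` for which every `i < p i` is an inversion of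
`w`, and the Bruhat interval becomes the set of `p` with `w * p ≤ w`. Sets of permutations are
compared through the sums of `sign p` over the members that fix a colouring `f`. Summed over all
`q`-colourings these give `∑ sign p * q ^ cyc p`, whose value at `q = -1` is the cardinality up to
sign (`card_eq_of_signed_sums`). For the rook board the signed sum is a determinant, equal to 1 if
`f` is a proper colouring of the inversion graph of `w` and to 0 otherwise (`det_inversionBoard`),
so the polynomial is the chromatic polynomial of that graph.

A set `Φ` with the same signed sums is built inside the interval by recursion on descents
(`exists_nbc_perms`). Hence the rook count is at most the size of the interval, with equality only
if `Φ` is everything. Cycles of members of `Φ` are connected in the inversion graph, whereas each of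
the four patterns yields an element of the interval with a disconnected cycle
(`rookPlacementsAvoiding_ne_of_containsPattern`).

Conversely, the interval lies in the set of permutations on the hull board
(`mem_boardPerms_hullBoard`). If `w` avoids the patterns, this set too has the same signed sums
(`signed_sum_hullBoard`), and the interval is squeezed between two sets of equal size. -/

/-! ### The strong Bruhat order -/

lemma length_mul_swap {n : ℕ} (a : Perm (Fin n)) {i j : Fin n} (hij : i < j) (h : a i < a j)
    (hb : ∀ k, i < k → k < j → a k < a i ∨ a j < a k) :
    length (a * swap i j) = length a + 1 := by
  have hmem : (i, j) ∈ Finset.univ.filter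
      fun p : Fin n × Fin n => p.1 < p.2 ∧ (a * swap i j) p.2 < (a * swap i j) p.1 := by
    rw [Finset.mem_filter]
    simp [hij, h]
  unfold length
  rw [← Finset.card_erase_add_one hmem]
  congr 1
  -- Moves a pair by the transposition if the pair stays increasing, and leaves it alone otherwise.
  let ψ : Fin n × Fin n → Fin n × Fin n := fun p =>
    if swap i j p.1 < swap i j p.2 then (swap i j p.1, swap i j p.2) else p
  clear hmem
  refine Finset.card_nbij' ψ ψ ?_ ?_ ?_ ?_
  all_goals
    rintro ⟨p, q⟩ hp
    rw [Finset.mem_coe] at hp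
    try rw [Finset.mem_coe]
    simp only [Finset.mem_erase, Finset.mem_filter, Finset.mem_univ, true_and] at hp ⊢
    try simp only [Perm.coe_mul, Function.comp_apply, ne_eq] at hp
    try simp only [Perm.coe_mul, Function.comp_apply, ne_eq]
    by_cases hs : swap i j p < swap i j q
    all_goals simp only [ψ, hs, if_true, if_false, swap_apply_self]
    all_goals grind

/-- Induction on the total gap in positions and values. If some `a k` lies in between, `(i j) = (i
k)(i j)(k j)` splits the move into three inversion-creating moves of smaller gap. -/
lemma BruhatLE.mul_swap {n : ℕ} (a : Perm (Fin n)) {i j : Fin n} (hij : i < j) (h : a i < a j) :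
    BruhatLE a (a * swap i j) := by
  obtain ⟨m, hm⟩ : ∃ m : ℕ, (j : ℕ) - i + ((a j : ℕ) - a i) = m := ⟨_, rfl⟩
  induction m using Nat.strong_induction_on generalizing a i j with
  | _ m ih =>
    by_cases hb : ∀ k, i < k → k < j → a k < a i ∨ a j < a k
    · exact Relation.ReflTransGen.single ⟨i, j, hij.ne, rfl, length_mul_swap a hij h hb⟩
    · push Not at hb
      obtain ⟨k, hik, hkj, h1, h2⟩ := hb
      have h1 : a i < a k := lt_of_le_of_ne h1 fun e => hik.ne (a.injective e)
      have h2 : a k < a j := lt_of_le_of_ne h2 fun e => hkj.ne (a.injective e)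
      have e1 : (a * swap i k) i = a k := by simp
      have e2 : (a * swap i k) j = a j := by
        simp [swap_apply_of_ne_of_ne hij.ne' hkj.ne']
      have e3 : (a * swap i k * swap i j) k = a i := by
        simp [swap_apply_of_ne_of_ne hik.ne' hkj.ne]
      have e4 : (a * swap i k * swap i j) j = a k := by simp
      have s1 := ih _ (by simp only [Fin.lt_def] at *; omega) a hik h1 rfl
      have s2 := ih _ (by rw [e1, e2]; simp only [Fin.lt_def] at *; omega) (a * swap i k) hij
        (by rw [e1, e2]; exact h2) rfl
      have s3 := ih _ (by rw [e3, e4]; simp only [Fin.lt_def] at *; omega)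
        (a * swap i k * swap i j) hkj (by rw [e3, e4]; exact h1) rfl
      have e : a * swap i k * swap i j * swap k j = a * swap i j := by
        ext x
        simp only [Perm.coe_mul, Function.comp_apply, swap_apply_def]
        grind
      rw [e] at s3
      exact (s1.trans s2).trans s3

lemma BruhatLE.mul_swap_le {n : ℕ} (a : Perm (Fin n)) {i j : Fin n} (hij : i < j)
    (h : a j < a i) : BruhatLE (a * swap i j) a := by
  have := BruhatLE.mul_swap (a * swap i j) hij (by simpa using h)
  rwa [mul_assoc, swap_mul_self, mul_one] at this

lemma BruhatLE.length_le {n : ℕ} {u v : Perm (Fin n)} (h : BruhatLE u v) :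
    length u ≤ length v := by
  induction h with
  | refl => exact le_rfl
  | tail _ hc ih => obtain ⟨i, j, _, _, hl⟩ := hc; omega

lemma BruhatLE.eq_or_length_lt {n : ℕ} {u v : Perm (Fin n)} (h : BruhatLE u v) :
    u = v ∨ length u < length v := by
  induction h with
  | refl => exact Or.inl rfl
  | tail h' hc ih =>
    have := BruhatLE.length_le h'
    obtain ⟨i, j, _, _, hl⟩ := hc
    right; omega

/-- A Bruhat cover multiplies by a transposition that creates an inversion. -/
lemma BruhatCover.exists_lt {n : ℕ} {u v : Perm (Fin n)} (h : BruhatCover u v) :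
    ∃ i j : Fin n, i < j ∧ u i < u j ∧ v = u * swap i j := by
  obtain ⟨i, j, hij, rfl, hl⟩ := h
  have main : ∀ i j : Fin n, i < j → length (u * swap i j) = length u + 1 → u i < u j := by
    intro i j hij hl
    by_contra hc
    have hlt : u j < u i := lt_of_le_of_ne (not_lt.1 hc) fun e => hij.ne' (u.injective e)
    have := (BruhatLE.mul_swap_le u hij hlt).length_le
    omega
  rcases lt_or_gt_of_ne hij with hlt | hlt
  · exact ⟨i, j, hlt, main i j hlt hl, rfl⟩
  · rw [swap_comm] at hl ⊢
    exact ⟨j, i, hlt, main j i hlt hl, rfl⟩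

/-- Any property of permutations that is preserved by creating an inversion with a transposition is
monotone in the Bruhat order. -/
lemma BruhatLE.induction_up {n : ℕ} {P : Perm (Fin n) → Prop}
    (hP : ∀ (a : Perm (Fin n)) (i j : Fin n), i < j → a i < a j → P a → P (a * swap i j))
    {u v : Perm (Fin n)} (h : BruhatLE u v) (hu : P u) : P v := by
  induction h with
  | refl => exact hu
  | tail _ hc ih =>
    obtain ⟨i, j, hij, hlt, rfl⟩ := hc.exists_lt
    exact hP _ i j hij hlt ih

lemma swap_lt_swap {n : ℕ} {k l i j : Fin n} (hkl : (k : ℕ) + 1 = l) (hij : i < j)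
    (hne : ¬(i = k ∧ j = l)) : swap k l i < swap k l j := by
  simp only [swap_apply_def]
  grind

/-- The lifting property for an adjacent transposition. -/
lemma BruhatLE.lift_swap {n : ℕ} {x y : Perm (Fin n)} (h : BruhatLE x y) {k l : Fin n}
    (hkl : (k : ℕ) + 1 = l) :
    BruhatLE (x * swap k l) y ∨ BruhatLE (x * swap k l) (y * swap k l) := by
  induction h using Relation.ReflTransGen.head_induction_on with
  | refl => exact Or.inr Relation.ReflTransGen.refl
  | @head a c hc hcy ih =>
    obtain ⟨i, j, hij, hlt, rfl⟩ := hc.exists_lt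
    by_cases hs : i = k ∧ j = l
    · obtain ⟨rfl, rfl⟩ := hs
      exact Or.inl hcy
    -- The adjacent transposition `(k l)` reverses no pair of positions except `k, l`, so the
    -- conjugate of `(i j)` still creates an inversion.
    · have hlt' : swap k l i < swap k l j := swap_lt_swap hkl hij hs
      have e : a * swap k l * swap (swap k l i) (swap k l j) = a * swap i j * swap k l := by
        rw [swap_apply_apply, swap_inv]
        simp only [mul_assoc, swap_mul_self_mul]
      have st := BruhatLE.mul_swap (a * swap k l) hlt' (by simpa using hlt)
      rw [e] at st
      exact ih.imp st.trans st.trans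

lemma BruhatLE.mul_swap_mul_swap {n : ℕ} {x y : Perm (Fin n)} (h : BruhatLE x y) {k l : Fin n}
    (hkl : (k : ℕ) + 1 = l) (hy : y k < y l) : BruhatLE (x * swap k l) (y * swap k l) :=
  (h.lift_swap hkl).elim (fun h' => h'.trans (BruhatLE.mul_swap y (by grind) hy)) id

lemma exists_descent {n : ℕ} {w : Perm (Fin n)} (hw : w ≠ 1) :
    ∃ k l : Fin n, (k : ℕ) + 1 = l ∧ w l < w k := by
  by_contra hc
  push Not at hc
  apply hw
  have hm : StrictMono w := by
    rcases n with _ | n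
    · intro a; exact a.elim0
    · refine Fin.strictMono_iff_lt_succ.2 fun i => ?_
      refine lt_of_le_of_ne (hc i.castSucc i.succ (by simp)) fun e => ?_
      exact (Fin.castSucc_lt_succ (i := i)).ne (w.injective e)
  have : (hm.orderIsoOfSurjective w w.surjective) = OrderIso.refl _ := Subsingleton.elim _ _
  ext x
  have := congrArg (fun e : Fin n ≃o Fin n => ((e x : Fin n) : ℕ)) this
  simpa using this

lemma length_mul_swap_lt {n : ℕ} {w : Perm (Fin n)} {k l : Fin n} (hkl : k < l)
    (h : w l < w k) : length (w * swap k l) < length w := by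
  refine (BruhatLE.mul_swap_le w hkl h).eq_or_length_lt.resolve_left fun e => ?_
  have := congrArg (fun v : Perm (Fin n) => v k) e
  simp only [Perm.coe_mul, Function.comp_apply, swap_apply_left] at this
  exact h.ne this

lemma one_bruhatLE {n : ℕ} (w : Perm (Fin n)) : BruhatLE 1 w := by
  obtain ⟨m, hm⟩ : ∃ m, length w = m := ⟨_, rfl⟩
  induction m using Nat.strong_induction_on generalizing w with
  | _ m ih =>
    by_cases hw : w = 1
    · rw [hw]; exact Relation.ReflTransGen.refl
    · obtain ⟨k, l, hkl, hlt⟩ := exists_descent hw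
      have hkl' : k < l := by grind
      exact (ih _ (hm ▸ length_mul_swap_lt hkl' hlt) _ rfl).trans
        (BruhatLE.mul_swap_le w hkl' hlt)

/-! ### Cardinalities from signed counts of colourings -/

/-- The number of `q`-colourings fixed by a permutation is a power of `q`, and the parity of the
exponent (the number of cycles) determines the sign. -/
lemma exists_card_fixed_colorings (n : ℕ) (p : Perm (Fin n)) :
    ∃ c : ℕ, (∀ q : ℕ, Fintype.card {f : Fin n → Fin q // ∀ i, f (p i) = f i} = q ^ c) ∧
      ((Perm.sign p : ℤ) = (-1) ^ (n + c)) := by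
  induction n with
  | zero =>
    refine ⟨0, fun q => ?_, ?_⟩
    · rw [pow_zero, Fintype.card_eq_one_iff]
      exact ⟨⟨fun i => i.elim0, fun i => i.elim0⟩, fun y => Subtype.ext (Subsingleton.elim _ _)⟩
    · rw [Subsingleton.elim p 1]; simp
  | succ n ih =>
    obtain ⟨⟨i, e⟩, rfl⟩ := Perm.decomposeFin.symm.surjective p
    obtain ⟨c, hc, hs⟩ := ih e
    induction i using Fin.cases with
    -- Here `0` is an extra fixed point and contributes a free colour.
    | zero =>
      refine ⟨c + 1, fun q => ?_, ?_⟩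
      · rw [pow_succ', ← hc q]
        have : Fintype.card (Fin q × {f : Fin n → Fin q // ∀ i, f (e i) = f i}) =
            q * Fintype.card {f : Fin n → Fin q // ∀ i, f (e i) = f i} := by simp
        rw [← this]
        refine Fintype.card_congr
          { toFun := fun f => (f.1 0, ⟨fun j => f.1 j.succ, fun j => ?_⟩)
            invFun := fun g => ⟨Fin.cons g.1 g.2.1, fun j => ?_⟩
            left_inv := fun f => ?_
            right_inv := fun g => ?_ }
        · have := f.2 j.succ
          rwa [Perm.decomposeFin_symm_apply_succ, swap_self, refl_apply] at this
        · induction j using Fin.cases with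
          | zero => rw [Perm.decomposeFin_symm_apply_zero]
          | succ j =>
            rw [Perm.decomposeFin_symm_apply_succ, swap_self, refl_apply, Fin.cons_succ,
              Fin.cons_succ, g.2.2]
        · ext j
          induction j using Fin.cases <;> simp
        · ext j <;> simp
      · rw [Perm.decomposeFin.symm_sign]
        simp [hs]; ring
    -- Here `0` is spliced into the cycle of `i.succ`: its colour is forced and no cycle is added.
    | succ i =>
      refine ⟨c, fun q => ?_, ?_⟩
      · rw [← hc q]
        have key : ∀ f : {f : Fin (n + 1) → Fin q //
            ∀ j, f (Perm.decomposeFin.symm (i.succ, e) j) = f j}, f.1 i.succ = f.1 0 := by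
          intro f
          have := f.2 0
          rwa [Perm.decomposeFin_symm_apply_zero] at this
        refine Fintype.card_congr
          { toFun := fun f => ⟨fun j => f.1 j.succ, fun j => ?_⟩
            invFun := fun g => ⟨Fin.cons (g.1 i) g.1, fun j => ?_⟩
            left_inv := fun f => ?_
            right_inv := fun g => ?_ }
        · have := f.2 j.succ
          rw [Perm.decomposeFin_symm_apply_succ] at this
          by_cases hj : (e j).succ = i.succ
          · rw [hj, swap_apply_right] at this
            show f.1 (e j).succ = f.1 j.succ
            rw [hj, key f, this]
          · rwa [swap_apply_of_ne_of_ne (Fin.succ_ne_zero _) hj] at this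
        · induction j using Fin.cases with
          | zero => rw [Perm.decomposeFin_symm_apply_zero]; simp
          | succ j =>
            rw [Perm.decomposeFin_symm_apply_succ]
            by_cases hj : (e j).succ = i.succ
            · have := Fin.succ_injective _ hj
              rw [hj, swap_apply_right, Fin.cons_zero, Fin.cons_succ, ← this, g.2]
            · rw [swap_apply_of_ne_of_ne (Fin.succ_ne_zero _) hj, Fin.cons_succ, Fin.cons_succ,
                g.2]
        · have := key f
          ext j
          induction j using Fin.cases <;> simp [this]
        · ext j; simp
      · rw [Perm.decomposeFin.symm_sign]
        simp [hs, Fin.succ_ne_zero]; ring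

/-- Two sets of permutations with the same signed counts of members fixing each colouring have the
same size. -/
lemma card_eq_of_signed_sums {n : ℕ} (X Y : Finset (Perm (Fin n)))
    (h : ∀ f : Fin n → ℕ, ∑ p ∈ X with ∀ i, f (p i) = f i, (Perm.sign p : ℤ) =
      ∑ p ∈ Y with ∀ i, f (p i) = f i, (Perm.sign p : ℤ)) : X.card = Y.card := by
  choose c hc hs using exists_card_fixed_colorings n
  let P : Finset (Perm (Fin n)) → Polynomial ℤ := fun Z =>
    ∑ p ∈ Z, Polynomial.C (Perm.sign p : ℤ) * Polynomial.X ^ c p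
  have hP : ∀ (Z : Finset (Perm (Fin n))) (q : ℕ), (P Z).eval (q : ℤ) =
      ∑ f : Fin n → Fin q, ∑ p ∈ Z with ∀ i, ((f (p i) : Fin q) : ℕ) = f i,
        (Perm.sign p : ℤ) := by
    intro Z q
    simp only [Finset.sum_filter, P, Polynomial.eval_finsetSum]
    rw [Finset.sum_comm]
    refine Finset.sum_congr rfl fun p _ => ?_
    rw [← Finset.sum_filter, Finset.sum_const, nsmul_eq_mul]
    have : (Finset.univ.filter fun f : Fin n → Fin q =>
        ∀ i, ((f (p i) : Fin q) : ℕ) = f i).card = q ^ c p := by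
      rw [← hc p q, Fintype.card_subtype]
      simp only [Fin.val_inj]
    rw [this]
    simp [mul_comm]
  have heq : P X = P Y := by
    refine Polynomial.eq_of_infinite_eval_eq _ _ ?_
    refine Set.Infinite.mono ?_ (Set.infinite_range_of_injective (f := fun q : ℕ => (q : ℤ))
      Nat.cast_injective)
    rintro _ ⟨q, rfl⟩
    show (P X).eval (q : ℤ) = (P Y).eval (q : ℤ)
    rw [hP, hP]
    exact Finset.sum_congr rfl fun f _ => h fun i => f i
  -- At `-1` the power `(-1) ^ c p` cancels the one in the sign, leaving `(-1) ^ n` for every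
  -- member.
  have hval : ∀ Z : Finset (Perm (Fin n)), (P Z).eval (-1) = (-1) ^ n * (Z.card : ℤ) := by
    intro Z
    simp only [P, Polynomial.eval_finsetSum]
    rw [Finset.card_eq_sum_ones, Nat.cast_sum, Finset.mul_sum]
    refine Finset.sum_congr rfl fun p _ => ?_
    rw [hs]
    simp only [Polynomial.eval_mul, Polynomial.eval_C, Polynomial.eval_pow, Polynomial.eval_X]
    rw [pow_add, mul_assoc, ← mul_pow]
    simp
  have := congrArg (Polynomial.eval (-1)) heq
  rw [hval, hval] at this
  have hne : ((-1 : ℤ)) ^ n ≠ 0 := pow_ne_zero _ (by norm_num)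
  exact_mod_cast mul_left_cancel₀ hne this

/-! ### Boards, determinants and rook placements -/

/-- A colouring of the positions of `w` is proper if inverted positions get different colours. -/
def IsProper {n : ℕ} (w : Perm (Fin n)) (f : Fin n → ℕ) : Prop :=
  ∀ i j, i < j → w j < w i → f i ≠ f j

/-- The matrix of the board `A`, restricted to the pairs of equal colour. -/
def boardMatrix {n : ℕ} (A : Fin n → Fin n → Prop) [∀ i j, Decidable (A i j)] (f : Fin n → ℕ) :
    Matrix (Fin n) (Fin n) ℤ :=
  Matrix.of fun a b => if A b a ∧ f a = f b then 1 else 0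

/-- The permutations placed on the board `A`. -/
def boardPerms {n : ℕ} (A : Fin n → Fin n → Prop) [∀ i j, Decidable (A i j)] :
    Finset (Perm (Fin n)) :=
  Finset.univ.filter fun p => ∀ i, A i (p i)

lemma mem_boardPerms {n : ℕ} {A : Fin n → Fin n → Prop} [∀ i j, Decidable (A i j)]
    {p : Perm (Fin n)} : p ∈ boardPerms A ↔ ∀ i, A i (p i) := by
  simp [boardPerms]

/-- Leibniz expansion. `boardMatrix` is transposed because `Matrix.det_apply'` uses the entries `(p
i, i)`. -/
lemma signed_sum_eq_det {n : ℕ} (A : Fin n → Fin n → Prop) [∀ i j, Decidable (A i j)]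
    (f : Fin n → ℕ) :
    ∑ p ∈ boardPerms A with ∀ i, f (p i) = f i, (Perm.sign p : ℤ) = (boardMatrix A f).det := by
  rw [Matrix.det_apply', boardPerms, Finset.filter_filter, Finset.sum_filter]
  refine Finset.sum_congr rfl fun p _ => ?_
  simp only [boardMatrix, Matrix.of_apply]
  rw [Finset.prod_ite_zero]
  simp only [Finset.mem_univ, true_implies, Finset.prod_const_one, ← forall_and]
  split_ifs <;> simp

/-- The cells `(i, j)` on or below the diagonal, or at inversions of `w`. -/
def inversionBoard {n : ℕ} (w : Perm (Fin n)) (i j : Fin n) : Prop := i < j → w j < w i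

instance {n : ℕ} (w : Perm (Fin n)) (i j : Fin n) : Decidable (inversionBoard w i j) :=
  inferInstanceAs (Decidable (i < j → w j < w i))

open Classical in
-- A proper colouring makes the matrix unitriangular; an improper one makes two columns equal.
lemma det_inversionBoard {n : ℕ} (w : Perm (Fin n)) (f : Fin n → ℕ) :
    (boardMatrix (inversionBoard w) f).det = if IsProper w f then 1 else 0 := by
  split_ifs with hf
  · rw [Matrix.det_of_isUpperTriangular]
    · simp [boardMatrix, inversionBoard]
    · intro a b hab
      simp only [id] at hab
      rw [boardMatrix, Matrix.of_apply, if_neg]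
      rintro ⟨h, e⟩
      exact hf b a hab (h hab) e.symm
  · simp only [IsProper] at hf
    push Not at hf
    obtain ⟨i₀, j₀, h₀, hw₀, hf₀⟩ := hf
    -- `j` is the last position that ends an inversion within the colour class, and `i` carries the
    -- largest value of the class up to `j`. On this class, columns `i` and `j` are full up to `j`
    -- and empty after it.
    obtain ⟨j, hj, hjmax⟩ := Finset.exists_max_image
      (Finset.univ.filter fun j => f j = f j₀ ∧ ∃ i, f i = f j₀ ∧ i < j ∧ w j < w i) id
      ⟨j₀, by simp only [Finset.mem_filter, Finset.mem_univ, true_and]; exact ⟨i₀, hf₀, h₀, hw₀⟩⟩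
    simp only [Finset.mem_filter, Finset.mem_univ, true_and, id] at hj hjmax
    obtain ⟨hfj, i₁, hfi₁, hi₁, hwi₁⟩ := hj
    obtain ⟨i, hi, himax⟩ := Finset.exists_max_image
      (Finset.univ.filter fun i => f i = f j₀ ∧ i ≤ j) w
      ⟨i₁, by simp only [Finset.mem_filter, Finset.mem_univ, true_and]; exact ⟨hfi₁, hi₁.le⟩⟩
    simp only [Finset.mem_filter, Finset.mem_univ, true_and] at hi himax
    have hwi : w j < w i := hwi₁.trans_le (himax i₁ ⟨hfi₁, hi₁.le⟩)
    have hij : i < j := lt_of_le_of_ne hi.2 (by rintro rfl; exact hwi.false)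
    refine Matrix.det_zero_of_column_eq hij.ne fun l => ?_
    simp only [boardMatrix, Matrix.of_apply]
    rw [hi.1, hfj]
    refine if_congr (and_congr_left fun e => ?_) rfl rfl
    simp only [inversionBoard]
    constructor
    · intro h hjl
      exact absurd (hjmax l ⟨e, i, hi.1, hij.trans hjl, h (hij.trans hjl)⟩) hjl.not_ge
    · intro h hil
      rcases le_or_gt l j with hlj | hlj
      · exact lt_of_le_of_ne (himax l ⟨e, hlj⟩) fun e' => hil.ne' (w.injective e')
      · exact (h hlj).trans hwi

lemma rookPlacementsAvoiding_eq {n : ℕ} (B : Set (Fin n × Fin n)) :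
    rookPlacementsAvoiding B = {u : Perm (Fin n) | ∀ i, (i, u i) ∉ B}.ncard := by
  have hinj : Function.Injective fun u : Perm (Fin n) =>
      Finset.univ.image fun i => (i, u i) := by
    intro u v h
    ext i
    have hm : (i, u i) ∈ Finset.univ.image fun i => (i, u i) :=
      Finset.mem_image_of_mem _ (Finset.mem_univ i)
    simp only at h
    rw [h] at hm
    obtain ⟨j, _, hj⟩ := Finset.mem_image.1 hm
    simp only [Prod.mk.injEq] at hj
    rw [← hj.2, hj.1]
  rw [rookPlacementsAvoiding, ← Set.ncard_image_of_injective _ hinj]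
  congr 1
  ext R
  constructor
  · rintro ⟨⟨hB, hR⟩, hc⟩
    have h1 : Set.InjOn Prod.fst (R : Set (Fin n × Fin n)) := by
      intro c hc d hd e
      by_contra hne
      exact (hR c hc d hd hne).1 e
    have h2 : Set.InjOn Prod.snd (R : Set (Fin n × Fin n)) := by
      intro c hc d hd e
      by_contra hne
      exact (hR c hc d hd hne).2 e
    have hfst : R.image Prod.fst = Finset.univ := by
      rw [← Finset.card_eq_iff_eq_univ, Finset.card_image_of_injOn h1, hc, Fintype.card_fin]
    have hex : ∀ i, ∃ j, (i, j) ∈ R := by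
      intro i
      have : i ∈ R.image Prod.fst := hfst ▸ Finset.mem_univ i
      obtain ⟨⟨a, b⟩, hab, rfl⟩ := Finset.mem_image.1 this
      exact ⟨b, hab⟩
    choose g hg using hex
    have hgi : Function.Injective g := fun i j e => congrArg Prod.fst (h2 (hg i) (hg j) e)
    refine ⟨Equiv.ofBijective g (Finite.injective_iff_bijective.1 hgi), fun i => hB _ (hg i), ?_⟩
    refine Finset.eq_of_subset_of_card_le ?_ ?_
    · intro c hc
      obtain ⟨i, _, rfl⟩ := Finset.mem_image.1 hc
      exact hg i
    · rw [hc, Finset.card_image_of_injective _ fun i j e => congrArg Prod.fst e]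
      simp
  · rintro ⟨u, hu, rfl⟩
    refine ⟨⟨fun c hc => ?_, fun c hc d hd hne => ?_⟩, ?_⟩
    · obtain ⟨i, _, rfl⟩ := Finset.mem_image.1 hc
      exact hu i
    · obtain ⟨i, _, rfl⟩ := Finset.mem_image.1 hc
      obtain ⟨j, _, rfl⟩ := Finset.mem_image.1 hd
      have hij : i ≠ j := by rintro rfl; exact hne rfl
      exact ⟨hij, fun e => hij (u.injective e)⟩
    · rw [Finset.card_image_of_injective _ fun i j e => congrArg Prod.fst e]
      simp

/-- Renaming the columns by `w`, that is `u = w * v`, carries one board to the other. -/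
lemma rookPlacementsAvoiding_swDiagram {n : ℕ} (w : Perm (Fin n)) :
    rookPlacementsAvoiding (swDiagram w) = (boardPerms (inversionBoard w)).card := by
  suffices himg : {u : Perm (Fin n) | ∀ i, (i, u i) ∉ swDiagram w} =
      (w * ·) '' (boardPerms (inversionBoard w) : Set (Perm (Fin n))) by
    rw [rookPlacementsAvoiding_eq, himg, Set.ncard_image_of_injective _ (mul_right_injective w),
      Set.ncard_coe_finset]
  ext u
  constructor
  · intro hu
    refine ⟨w⁻¹ * u, ?_, by simp⟩
    refine mem_boardPerms.2 fun i hi => ?_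
    by_contra hc
    refine hu i ⟨i, (w⁻¹ * u) i, hi, ?_, by simp⟩
    exact lt_of_le_of_ne (not_lt.1 hc) fun e => hi.ne (w.injective e)
  · rintro ⟨v, hv, rfl⟩ i ⟨i', j, hij, hw, e⟩
    have hv := mem_boardPerms.1 (Finset.mem_coe.1 hv)
    simp only [Perm.coe_mul, Function.comp_apply, Prod.mk.injEq, EmbeddingLike.apply_eq_iff_eq] at e
    obtain ⟨rfl, rfl⟩ := e
    exact (hv i hij).not_gt hw

/-! ### Permutations below `w` with connected cycles -/

/-- If a colouring fixed by `p` separates `k` and `l`, that is, if they lie in different cycles of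
`p`, then they lie in the same cycle of `p * swap k l`. -/
lemma eq_of_fixed_mul_swap {n : ℕ} {p : Perm (Fin n)} {k l : Fin n} {f h : Fin n → ℕ}
    (hf : ∀ i, f (p i) = f i) (hkl : f k ≠ f l) (hh : ∀ i, h ((p * swap k l) i) = h i) :
    h k = h l := by
  -- `p` maps `insert k D` into `D`, which contradicts injectivity if `k ∉ D`.
  set D := Finset.univ.filter fun x => f x = f k ∧ h x = h l with hD
  have hsub : (insert k D).image p ⊆ D := by
    intro y hy
    obtain ⟨x, hx, rfl⟩ := Finset.mem_image.1 hy
    rw [hD, Finset.mem_filter]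
    refine ⟨Finset.mem_univ _, ?_⟩
    have hl := hh l
    rw [Perm.mul_apply, swap_apply_right] at hl
    rcases Finset.mem_insert.1 hx with rfl | hx
    · exact ⟨hf x, hl⟩
    · obtain ⟨h1, h2⟩ := (Finset.mem_filter.1 hx).2
      refine ⟨(hf x).trans h1, ?_⟩
      by_cases hxk : x = k
      · rw [hxk, hl]
      · have hx' := hh x
        rw [Perm.mul_apply, swap_apply_of_ne_of_ne hxk (fun e => hkl (h1.symm.trans (e ▸ rfl)))]
          at hx'
        rw [hx', h2]
  by_contra hne
  have hk : k ∉ D := by simp [hD, hne]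
  have := Finset.card_le_card hsub
  rw [Finset.card_image_of_injective _ p.injective, Finset.card_insert_of_notMem hk] at this
  omega

lemma forall_apply_mul_swap_iff {n : ℕ} {p : Perm (Fin n)} {k l : Fin n} {f : Fin n → ℕ}
    (hkl : f k = f l) :
    (∀ i, f ((p * swap k l) i) = f i) ↔ ∀ i, f (p i) = f i := by
  have hs : ∀ i, f (swap k l i) = f i := fun i => by
    rw [swap_apply_def]; split_ifs with h1 h2
    · rw [h1, hkl]
    · rw [h2, hkl]
    · rfl
  constructor
  · intro h i
    have := h (swap k l i)
    rwa [Perm.mul_apply, swap_apply_self, hs] at this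
  · intro h i
    rw [Perm.mul_apply, h, hs]

lemma forall_apply_conj_swap_iff {n : ℕ} {p : Perm (Fin n)} {k l : Fin n} {f : Fin n → ℕ} :
    (∀ i, f ((swap k l * p * swap k l) i) = f i) ↔
      ∀ i, f (swap k l (p i)) = f (swap k l i) := by
  constructor
  · intro h i
    have := h (swap k l i)
    rwa [Perm.mul_apply, Perm.mul_apply, swap_apply_self] at this
  · intro h i
    rw [Perm.mul_apply, Perm.mul_apply, h, swap_apply_self]

open Classical in
/-- A set of permutations `p` with `w * p ≤ w`, built from a reduced word of `w` (it is indexed by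
the sets of inversions without broken circuits). Its signed counts are those of the proper
colourings of the inversion graph, and the cycles of its members are connected in that graph. -/
theorem exists_nbc_perms {n : ℕ} (w : Perm (Fin n)) :
    ∃ Φ : Finset (Perm (Fin n)), (∀ p ∈ Φ, BruhatLE (w * p) w) ∧
      (∀ f : Fin n → ℕ, ∑ p ∈ Φ with ∀ i, f (p i) = f i, (Perm.sign p : ℤ) =
        if IsProper w f then 1 else 0) ∧
      ∀ p ∈ Φ, ∀ f g : Fin n → ℕ, (∀ i, f (p i) = f i) →
        (∀ i j, i < j → w j < w i → f i = f j → g i = g j) → ∀ i, g (p i) = g i := by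
  obtain ⟨m, hm⟩ : ∃ m, length w = m := ⟨_, rfl⟩
  induction m using Nat.strong_induction_on generalizing w with
  | _ m ih =>
  by_cases hw : w = 1
  · subst hw
    refine ⟨{1}, ?_, ?_, ?_⟩
    · intro p hp
      rw [Finset.mem_singleton.1 hp]
      exact Relation.ReflTransGen.refl
    · intro f
      have : IsProper (1 : Perm (Fin n)) f := fun i j hij h => absurd h hij.not_gt
      rw [if_pos this, Finset.filter_true_of_mem]
      · simp
      · intro p hp
        rw [Finset.mem_singleton.1 hp]
        simp
    · intro p hp
      rw [Finset.mem_singleton.1 hp]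
      simp
  obtain ⟨k, l, hkl, hlt⟩ := exists_descent hw
  have hkl' : k < l := by grind
  obtain ⟨Φ, hΦ1, hΦ2, hΦ3⟩ := ih _ (hm ▸ length_mul_swap_lt hkl' hlt) (w * swap k l) rfl
  set s := swap k l with hs
  have hss : s * s = 1 := swap_mul_self k l
  have hasc : (w * s) k < (w * s) l := by simpa [hs] using hlt
  -- The conjugates in which `k` and `l` lie in different cycles, expressed by a fixed colouring
  -- that separates them.
  set A := (Φ.image fun p => s * p * s).filter
    fun p => ∃ f : Fin n → ℕ, (∀ i, f (p i) = f i) ∧ f k ≠ f l with hA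
  have hAmem : ∀ p ∈ A, ∃ q ∈ Φ, s * q * s = p := fun p hp =>
    Finset.mem_image.1 (Finset.mem_filter.1 hp).1
  have hAsep : ∀ p ∈ A, ∀ h : Fin n → ℕ, (∀ i, h ((p * s) i) = h i) → h k = h l := by
    intro p hp h hh
    obtain ⟨f, hf, hne⟩ := (Finset.mem_filter.1 hp).2
    exact eq_of_fixed_mul_swap hf hne hh
  -- The inversion graph of `w` is that of `w * s`, relabelled by `s`, with the extra edge `k l`.
  have hedge : ∀ i j, i < j → (w * s) j < (w * s) i → s i < s j := by
    intro i j hij h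
    refine swap_lt_swap hkl hij ?_
    rintro ⟨rfl, rfl⟩
    exact h.not_gt hasc
  have hcon : ∀ p ∈ A, ∀ f g : Fin n → ℕ, (∀ i, f (p i) = f i) →
      (∀ i j, i < j → w j < w i → f i = f j → g i = g j) → ∀ i, g (p i) = g i := by
    intro p hp f g hf hg
    obtain ⟨q, hq, rfl⟩ := hAmem p hp
    refine forall_apply_conj_swap_iff.2 (hΦ3 q hq (fun i => f (s i)) (fun i => g (s i))
      (forall_apply_conj_swap_iff.1 hf) ?_)
    intro i j hij hwij
    exact hg _ _ (hedge i j hij hwij) hwij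
  -- Deletion–contraction for the edge `k l`: each `p ∈ A` is kept, and `p * s`, of opposite sign,
  -- merges the cycles of `k` and `l`.
  refine ⟨A ∪ A.image (· * s), ?_, ?_, ?_⟩
  · intro p hp
    rcases Finset.mem_union.1 hp with hp | hp
    · obtain ⟨q, hq, rfl⟩ := hAmem p hp
      have := (hΦ1 q hq).mul_swap_mul_swap hkl hasc
      rwa [← hs, mul_assoc w s s, hss, mul_one, mul_assoc, mul_assoc, ← mul_assoc s] at this
    · obtain ⟨p', hp', rfl⟩ := Finset.mem_image.1 hp
      obtain ⟨q, hq, rfl⟩ := hAmem p' hp'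
      have e : w * (s * q * s * s) = w * s * q := by
        rw [mul_assoc (s * q), hss, mul_one, mul_assoc]
      have e' : BruhatLE (w * s) w := BruhatLE.mul_swap_le w hkl' hlt
      rw [e]
      exact (hΦ1 q hq).trans e'
  · intro f
    have hdisj : Disjoint A (A.image (· * s)) := by
      rw [Finset.disjoint_left]
      intro p hp hp'
      obtain ⟨q, hq, rfl⟩ := Finset.mem_image.1 hp'
      obtain ⟨f, hf, hne⟩ := (Finset.mem_filter.1 hp).2
      exact hne (hAsep q hq f hf)
    have hsum : ∑ p ∈ A ∪ A.image (· * s) with ∀ i, f (p i) = f i, (Perm.sign p : ℤ) =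
        ∑ p ∈ A, ((if ∀ i, f (p i) = f i then (Perm.sign p : ℤ) else 0) -
          if ∀ i, f ((p * s) i) = f i then (Perm.sign p : ℤ) else 0) := by
      rw [Finset.sum_filter, Finset.sum_union hdisj,
        Finset.sum_image fun a _ b _ e => mul_right_cancel e, Finset.sum_sub_distrib,
        sub_eq_add_neg, ← Finset.sum_neg_distrib]
      congr 1
      refine Finset.sum_congr rfl fun p _ => ?_
      rw [← neg_zero, apply_ite Neg.neg, neg_zero, Perm.sign_mul, hs, Perm.sign_swap hkl'.ne]
      simp
    rw [hsum]
    -- If `f k = f l`, then `p` and `p * s` cancel. Otherwise `p * s` never fixes `f`, and every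
    -- conjugate that fixes `f` lies in `A`, with `f` itself as the witness.
    by_cases hf : f k = f l
    · rw [if_neg fun h => h k l hkl' hlt hf]
      refine Finset.sum_eq_zero fun p _ => ?_
      simp only [hs, forall_apply_mul_swap_iff hf, sub_self]
    · have hprop : IsProper w f ↔ IsProper (w * s) fun i => f (s i) := by
        constructor
        · intro h i j hij hw
          exact h _ _ (hedge i j hij hw) hw
        · intro h i j hij hw
          by_cases he : i = k ∧ j = l
          · rw [he.1, he.2]; exact hf
          · have := h _ _ (swap_lt_swap hkl hij he) (by simpa [hs] using hw)
            simpa [hs] using this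
      rw [if_congr hprop rfl rfl, ← hΦ2]
      have h1 : ∀ p ∈ A, ((if ∀ i, f (p i) = f i then (Perm.sign p : ℤ) else 0) -
          if ∀ i, f ((p * s) i) = f i then (Perm.sign p : ℤ) else 0) =
          if ∀ i, f (p i) = f i then (Perm.sign p : ℤ) else 0 := by
        intro p hp
        rw [if_neg (fun h => hf (hAsep p hp f h)), sub_zero]
      rw [Finset.sum_congr rfl h1, ← Finset.sum_filter, hA, Finset.filter_filter]
      have h2 : ((Φ.image fun p => s * p * s).filter fun p =>
          (∃ f : Fin n → ℕ, (∀ i, f (p i) = f i) ∧ f k ≠ f l) ∧ ∀ i, f (p i) = f i) =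
          (Φ.image fun p => s * p * s).filter fun p => ∀ i, f (p i) = f i := by
        refine Finset.filter_congr fun p _ => ?_
        exact ⟨fun h => h.2, fun h => ⟨⟨f, h, hf⟩, h⟩⟩
      rw [h2, Finset.sum_filter, Finset.sum_filter,
        Finset.sum_image fun a _ b _ e => mul_left_cancel (mul_right_cancel e)]
      refine Finset.sum_congr rfl fun p _ => ?_
      refine if_congr forall_apply_conj_swap_iff ?_ rfl
      rw [Perm.sign_mul, Perm.sign_mul, mul_right_comm, ← Perm.sign_mul, hss]
      simp
  · intro p hp
    rcases Finset.mem_union.1 hp with hp | hp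
    · exact hcon p hp
    · obtain ⟨q, hq, rfl⟩ := Finset.mem_image.1 hp
      intro f g hf hg
      have hfkl := hAsep q hq f hf
      have hgkl := hg k l hkl' hlt hfkl
      exact (forall_apply_mul_swap_iff hgkl).2
        (hcon q hq f g ((forall_apply_mul_swap_iff hfkl).1 hf) hg)

/-! ### The hull board and the four patterns -/

/-- The cells `(i, w j)` that have a rook of `w` weakly to the north-east and one weakly to the
south-west. -/
def hullBoard {n : ℕ} (w : Perm (Fin n)) (i j : Fin n) : Prop :=
  (∃ a, a ≤ i ∧ w j ≤ w a) ∧ ∃ a, i ≤ a ∧ w a ≤ w j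

instance {n : ℕ} (w : Perm (Fin n)) (i j : Fin n) : Decidable (hullBoard w i j) :=
  inferInstanceAs (Decidable ((∃ a, a ≤ i ∧ w j ≤ w a) ∧ ∃ a, i ≤ a ∧ w a ≤ w j))

/-- The existence of a rook weakly north-east (or south-west) of a fixed cell persists when a
transposition creates an inversion; for `u`, the rook `(i, u i)` serves as both. -/
lemma mem_boardPerms_hullBoard {n : ℕ} {u w : Perm (Fin n)} (h : BruhatLE u w) :
    w⁻¹ * u ∈ boardPerms (hullBoard w) := by
  refine mem_boardPerms.2 fun i => ?_
  rw [hullBoard, Perm.mul_apply, show w (w⁻¹ (u i)) = u i from w.apply_symm_apply _]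
  constructor
  · refine h.induction_up (P := fun v => ∃ a, a ≤ i ∧ u i ≤ v a) ?_ ⟨i, le_rfl, le_rfl⟩
    rintro v x y hxy hv ⟨a, ha, hua⟩
    by_cases hax : a = x
    · exact ⟨x, hax ▸ ha, by rw [Perm.mul_apply, swap_apply_left]; exact (hax ▸ hua).trans hv.le⟩
    by_cases hay : a = y
    · exact ⟨x, hxy.le.trans (hay ▸ ha), by
        rw [Perm.mul_apply, swap_apply_left]; exact hay ▸ hua⟩
    exact ⟨a, ha, by rwa [Perm.mul_apply, swap_apply_of_ne_of_ne hax hay]⟩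
  · refine h.induction_up (P := fun v => ∃ a, i ≤ a ∧ v a ≤ u i) ?_ ⟨i, le_rfl, le_rfl⟩
    rintro v x y hxy hv ⟨a, ha, hua⟩
    by_cases hax : a = x
    · exact ⟨y, (hax ▸ ha).trans hxy.le, by
        rw [Perm.mul_apply, swap_apply_right]; exact hax ▸ hua⟩
    by_cases hay : a = y
    · exact ⟨y, hay ▸ ha, by
        rw [Perm.mul_apply, swap_apply_right]; exact hv.le.trans (hay ▸ hua)⟩
    exact ⟨a, ha, by rwa [Perm.mul_apply, swap_apply_of_ne_of_ne hax hay]⟩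

section Patterns

variable {n : ℕ} {w : Perm (Fin n)}

lemma containsPattern_4231 {a b c d : Fin n} (h1 : a < b) (h2 : b < c) (h3 : c < d)
    (v1 : w d < w b) (v2 : w b < w c) (v3 : w c < w a) : ContainsPattern w ![4, 2, 3, 1] := by
  refine ⟨![a, b, c, d], Fin.strictMono_iff_lt_succ.2 fun i => ?_, fun x y => ?_⟩
  · fin_cases i <;> assumption
  · fin_cases x <;> fin_cases y <;> simp <;> order

lemma containsPattern_35142 {a b c d e : Fin n} (h1 : a < b) (h2 : b < c) (h3 : c < d) (h4 : d < e)
    (v1 : w c < w e) (v2 : w e < w a) (v3 : w a < w d) (v4 : w d < w b) :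
    ContainsPattern w ![3, 5, 1, 4, 2] := by
  refine ⟨![a, b, c, d, e], Fin.strictMono_iff_lt_succ.2 fun i => ?_, fun x y => ?_⟩
  · fin_cases i <;> assumption
  · fin_cases x <;> fin_cases y <;> simp <;> order

lemma containsPattern_42513 {a b c d e : Fin n} (h1 : a < b) (h2 : b < c) (h3 : c < d) (h4 : d < e)
    (v1 : w d < w b) (v2 : w b < w e) (v3 : w e < w a) (v4 : w a < w c) :
    ContainsPattern w ![4, 2, 5, 1, 3] := by
  refine ⟨![a, b, c, d, e], Fin.strictMono_iff_lt_succ.2 fun i => ?_, fun x y => ?_⟩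
  · fin_cases i <;> assumption
  · fin_cases x <;> fin_cases y <;> simp <;> order

lemma containsPattern_351624 {a b c d e g : Fin n} (h1 : a < b) (h2 : b < c) (h3 : c < d)
    (h4 : d < e) (h5 : e < g) (v1 : w c < w e) (v2 : w e < w a) (v3 : w a < w g) (v4 : w g < w b)
    (v5 : w b < w d) : ContainsPattern w ![3, 5, 1, 6, 2, 4] := by
  refine ⟨![a, b, c, d, e, g], Fin.strictMono_iff_lt_succ.2 fun i => ?_, fun x y => ?_⟩
  · fin_cases i <;> assumption
  · fin_cases x <;> fin_cases y <;> simp <;> order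

/-- At every row `m`, the set `S` of positions has cells of the hull of `w` on both sides of the
diagonal that cross from above `m` to below. -/
def HullConnected (w : Perm (Fin n)) (S : Finset (Fin n)) : Prop :=
  ∀ m : ℕ, (∃ s ∈ S, (s : ℕ) < m) → (∃ z ∈ S, m ≤ (z : ℕ)) →
    (∃ s ∈ S, ∃ z ∈ S, (s : ℕ) < m ∧ m ≤ (z : ℕ) ∧ hullBoard w s z) ∧
      ∃ s ∈ S, ∃ z ∈ S, (s : ℕ) < m ∧ m ≤ (z : ℕ) ∧ hullBoard w z s

/-- If `w` increased along `S`, the cells crossing between consecutive elements `t < z` would supply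
`e < t` with value above `w z` and `a > z` with value below `w t`, so `e t z a` would be a 4231. -/
lemma HullConnected.exists_inversion (h4231 : AvoidsPattern w ![4, 2, 3, 1]) {S : Finset (Fin n)}
    (hS : HullConnected w S) {s z : Fin n} (hs : s ∈ S) (hz : z ∈ S) (hsz : s < z) :
    ∃ i ∈ S, ∃ j ∈ S, i < j ∧ w j < w i := by
  by_contra hc
  push Not at hc
  have hmono : ∀ i ∈ S, ∀ j ∈ S, i ≤ j → w i ≤ w j := fun i hi j hj hij => by
    rcases hij.eq_or_lt with rfl | hij
    · exact le_rfl
    · exact hc i hi j hj hij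
  obtain ⟨t, ht, htmax⟩ := Finset.exists_max_image (S.filter (· < z)) id
    ⟨s, Finset.mem_filter.2 ⟨hs, hsz⟩⟩
  simp only [Finset.mem_filter, id] at ht htmax
  obtain ⟨⟨s', hs', z', hz', hs'm, hz'm, ⟨e, he, hwe⟩, -⟩, s'', hs'', z'', hz'', hs''m, hz''m, -,
    a, ha, hwa⟩ := hS z ⟨s, hs, hsz⟩ ⟨z, hz, le_rfl⟩
  have htz : w t < w z := lt_of_le_of_ne (hmono t ht.1 z hz ht.2.le) fun e => ht.2.ne (w.injective e)
  have h1 : w z ≤ w e := (hmono z hz z' hz' hz'm).trans hwe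
  have h2 : w a ≤ w t := hwa.trans (hmono s'' hs'' t ht.1 (htmax s'' ⟨hs'', hs''m⟩))
  have het : e < t := lt_of_le_of_ne (he.trans (htmax s' ⟨hs', hs'm⟩)) (by rintro rfl; order)
  have hza : z < a := lt_of_le_of_ne (le_trans (show z ≤ z'' from hz''m) ha) (by rintro rfl; order)
  refine h4231 (containsPattern_4231 het ht.2 hza (lt_of_le_of_ne h2 ?_) htz
    (lt_of_le_of_ne h1 ?_))
  · intro e'
    have := w.injective e'
    order
  · intro e'
    have := w.injective e'
    order

/-- Two rows or two columns of the hull coincide on a connected set of at least two positions. -/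
lemma HullConnected.exists_eq (h4231 : AvoidsPattern w ![4, 2, 3, 1])
    (h35142 : AvoidsPattern w ![3, 5, 1, 4, 2]) (h42513 : AvoidsPattern w ![4, 2, 5, 1, 3])
    (h351624 : AvoidsPattern w ![3, 5, 1, 6, 2, 4]) {S : Finset (Fin n)}
    (hS : HullConnected w S) (hcard : 1 < S.card) :
    (∃ p ∈ S, ∃ q ∈ S, p ≠ q ∧ ∀ j ∈ S, hullBoard w p j ↔ hullBoard w q j) ∨
      ∃ a ∈ S, ∃ b ∈ S, a ≠ b ∧ ∀ i ∈ S, hullBoard w i a ↔ hullBoard w i b := by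
  have hlt : ∀ {x y : Fin n}, w x ≤ w y → x ≠ y → w x < w y := fun h hne =>
    lt_of_le_of_ne h fun e => hne (w.injective e)
  obtain ⟨r, hr, hrmin⟩ := Finset.exists_min_image S w (Finset.card_pos.1 (by omega))
  -- If every row of `S` has a rook south-west of its cell in the lowest column `r`, then the
  -- columns of the two smallest values in `S` are both full on `S`.
  by_cases hfull : ∀ i ∈ S, ∃ a, i ≤ a ∧ w a ≤ w r
  · right
    obtain ⟨r', hr', hr'min⟩ := Finset.exists_min_image (S.erase r) w
      (Finset.card_pos.1 (by rw [Finset.card_erase_of_mem hr]; omega))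
    have hr'S := Finset.mem_of_mem_erase hr'
    have hne : r' ≠ r := Finset.ne_of_mem_erase hr'
    refine ⟨r, hr, r', hr'S, hne.symm, fun i hi => iff_of_true ⟨⟨i, le_rfl, hrmin i hi⟩, hfull i hi⟩
      ⟨?_, ?_⟩⟩
    · by_cases hir : i = r
      · subst hir
        by_cases hz : ∃ z ∈ S, i < z
        · obtain ⟨⟨s, hs, z, hz, hsm, hzm, ⟨e, he, hwe⟩, -⟩, -⟩ :=
            hS (i + 1) ⟨i, hr, by omega⟩ (by obtain ⟨z, hz, h⟩ := hz; exact ⟨z, hz, by omega⟩)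
          refine ⟨e, by omega, (hr'min z (Finset.mem_erase.2 ⟨?_, hz⟩)).trans hwe⟩
          rintro rfl
          omega
        · push Not at hz
          exact ⟨r', hz r' hr'S, le_rfl⟩
      · exact ⟨i, le_rfl, hr'min i (Finset.mem_erase.2 ⟨hir, hi⟩)⟩
    · obtain ⟨a, ha, hwa⟩ := hfull i hi
      exact ⟨a, ha, hwa.trans (hrmin r' hr'S)⟩
  left
  push Not at hfull
  obtain ⟨j₀, hj₀, hj₀w⟩ := hfull
  -- `q` is the last row of `S` with such a rook, namely `Y`, and `p` will be its predecessor in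
  -- `S`. `Y` settles the south-west condition for both rows, so they can differ only through a rook
  -- `x` with `p < x ≤ q`.
  obtain ⟨q, hq, hqmax⟩ := Finset.exists_max_image (S.filter fun i => ∃ a, i ≤ a ∧ w a ≤ w r) id
    ⟨r, Finset.mem_filter.2 ⟨hr, r, le_rfl, le_rfl⟩⟩
  simp only [Finset.mem_filter, id] at hq hqmax
  obtain ⟨hqS, Y, hqY, hwY⟩ := hq
  have hrq : r ≤ q := hqmax r ⟨hr, r, le_rfl, le_rfl⟩
  have hafter : ∀ i ∈ S, q < i → ∀ a, i ≤ a → w r < w a := by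
    intro i hi hqi a ha
    by_contra hc
    exact absurd (hqmax i ⟨hi, a, ha, not_lt.1 hc⟩) hqi.not_ge
  have hqj₀ : q < j₀ := by
    by_contra hc
    exact absurd (hj₀w Y ((not_lt.1 hc).trans hqY)) hwY.not_gt
  have hbefore : (S.filter (· < q)).Nonempty := by
    by_contra hc
    have hge : ∀ i ∈ S, q ≤ i := fun i hi => by
      by_contra hlt'
      exact hc ⟨i, Finset.mem_filter.2 ⟨hi, not_le.1 hlt'⟩⟩
    obtain ⟨-, s, hs, z, hz, hsm, hzm, -, a, ha, hwa⟩ :=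
      hS (q + 1) ⟨q, hqS, by omega⟩ ⟨j₀, hj₀, by omega⟩
    have hsq : s = r := by
      have := hge s hs
      have := hge r hr
      omega
    exact absurd (hafter z hz (by omega) a ha) (not_lt.2 (hsq ▸ hwa))
  obtain ⟨p, hp, hpmax⟩ := Finset.exists_max_image _ id hbefore
  simp only [Finset.mem_filter, id] at hp hpmax
  refine ⟨p, hp.1, q, hqS, hp.2.ne, fun j hj => ?_⟩
  have hSW : ∀ i ≤ q, ∃ a, i ≤ a ∧ w a ≤ w j := fun i hi =>
    ⟨Y, hi.trans hqY, hwY.trans (hrmin j hj)⟩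
  refine and_congr ⟨fun ⟨a, ha, h⟩ => ⟨a, ha.trans hp.2.le, h⟩, ?_⟩
    (iff_of_true (hSW p hp.2.le) (hSW q le_rfl))
  rintro ⟨x, hxq, hwx⟩
  by_contra hNE
  push Not at hNE
  exfalso
  -- For `r < q`, avoiding 4231 at `e r t Y` pushes `z` beyond `Y`, and then `e r q Y z` is a 42513.
  rcases hrq.lt_or_eq with hrq | hrq
  · have hYr : Y ≠ r := (hrq.trans_le hqY).ne'
    have hwYr : w Y < w r := hlt hwY hYr
    have hqr : w r < w q := hlt (hrmin q hqS) hrq.ne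
    have hqY' : q < Y := lt_of_le_of_ne hqY (by rintro rfl; order)
    obtain ⟨⟨s, hs, z, hz, hsm, hzm, ⟨e, he, hwe⟩, -⟩, -⟩ :=
      hS (r + 1) ⟨r, hr, by omega⟩ ⟨q, hqS, by omega⟩
    have hrz : r < z := by omega
    have hwrz : w r < w z := hlt (hrmin z hz) hrz.ne
    have her : e < r := lt_of_le_of_ne (by omega) (by rintro rfl; order)
    have hwze : w z < w e := hlt hwe (by omega)
    have hbig : ∀ t, r < t → t < Y → w r < w t → w e < w t := by
      intro t hrt htY hwt
      by_contra hc
      exact h4231 (containsPattern_4231 her hrt htY hwYr hwt (hlt (not_lt.1 hc) (by omega)))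
    have hYz : Y < z := by
      rcases lt_trichotomy z Y with h | h | h
      · exact absurd (hbig z hrz h hwrz) hwze.not_gt
      · subst h; order
      · exact h
    exact h42513 (containsPattern_42513 her hrq hqY' hYz hwYr hwrz hwze (hbig q hrq hqY' hqr))
  -- Below, `e` has the largest value up to `p`, `z` is the first element of `S` after `r` exceeding
  -- `w e`, and the crossing at `z` gives `y > z` with `w r < w y < w e`. Then `e x r z y` or `e x r
  -- j y` is a 35142, or `e x r z y j` is a 351624.
  · subst hrq
    have hrp : w r ≤ w p := hrmin p hp.1
    have hwpj := hNE p le_rfl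
    have hpx : p < x := by
      by_contra hc
      exact absurd (hNE x (not_lt.1 hc)) hwx.not_gt
    have hxr : x < r := lt_of_le_of_ne hxq (by rintro rfl; order)
    have hjr : r < j := by
      rcases lt_trichotomy j r with h | h | h
      · exact absurd (hNE j (hpmax j ⟨hj, h⟩)) (lt_irrefl _)
      · subst h; order
      · exact h
    have hwjx : w j < w x := hlt hwx (by omega)
    obtain ⟨e, he, hemax⟩ := Finset.exists_max_image (Finset.univ.filter (· ≤ p)) w
      ⟨p, by simp⟩
    simp only [Finset.mem_filter, Finset.mem_univ, true_and] at he hemax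
    have hwej := hNE e he
    obtain ⟨z, hz, hzmin⟩ := Finset.exists_min_image (S.filter fun z => r < z ∧ w e < w z) id
      ⟨j, Finset.mem_filter.2 ⟨hj, hjr, hwej⟩⟩
    simp only [Finset.mem_filter, id] at hz hzmin
    obtain ⟨hzS, hrz, hwez⟩ := hz
    have hzj : z ≤ j := hzmin j ⟨hj, hjr, hwej⟩
    obtain ⟨-, s, hs, z', hz', hsm, hzm, -, y, hy, hwy⟩ := hS z ⟨r, hr, hrz⟩ ⟨z, hzS, le_rfl⟩
    have hwse : w s ≤ w e := by
      rcases lt_trichotomy s r with h | h | h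
      · exact hemax s (hpmax s ⟨hs, h⟩)
      · subst h; exact hrp.trans (hemax p le_rfl)
      · by_contra hc
        have := hzmin s ⟨hs, h, not_le.1 hc⟩
        omega
    have hzy : z ≤ y := le_trans (show z ≤ z' from hzm) hy
    have hwye : w y < w e := hlt (hwy.trans hwse) (by omega)
    have hzy' : z < y := lt_of_le_of_ne hzy (by rintro rfl; order)
    have hwry : w r < w y := hafter z hzS hrz y hzy
    have hex : e < x := he.trans_lt hpx
    rcases lt_or_ge (w z) (w x) with h | h
    · exact h35142 (containsPattern_35142 hex hxr hrz hzy' hwry hwye hwez h)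
    · have hwxz : w x < w z := hlt h (by omega)
      have hzj' : z < j := lt_of_le_of_ne hzj (by rintro rfl; order)
      rcases lt_trichotomy j y with h' | h' | h'
      · exact h35142 (containsPattern_35142 hex hxr hjr h' hwry hwye hwej hwjx)
      · subst h'; order
      · exact h351624 (containsPattern_351624 hex hxr hrz hzy' h' hwry hwye hwej hwjx hwxz)

end Patterns

/-! ### Signed counts on the hull board -/

lemma perm_apply_mem_iff {n : ℕ} {p : Perm (Fin n)} {T : Finset (Fin n)}
    (h : ∀ i ∈ T, p i ∈ T) (i : Fin n) : p i ∈ T ↔ i ∈ T := by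
  refine ⟨fun hi => ?_, h i⟩
  have himg : T.image p = T := Finset.eq_of_subset_of_card_le
    (Finset.image_subset_iff.2 h) (Finset.card_image_of_injective _ p.injective).ge
  rw [← himg] at hi
  obtain ⟨j, hj, e⟩ := Finset.mem_image.1 hi
  rwa [← p.injective e]

lemma hullBoard_of_inversion {n : ℕ} {w : Perm (Fin n)} {i j : Fin n} (hij : i < j)
    (hw : w j < w i) : hullBoard w i j ∧ hullBoard w j i :=
  ⟨⟨⟨i, le_rfl, hw.le⟩, j, hij.le, le_rfl⟩, ⟨i, hij.le, le_rfl⟩, j, le_rfl, hw.le⟩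

open Classical in
-- Induction on the number of equally coloured pairs. A hull-connected class contains an inversion
-- and, having two equal rows or columns, kills the determinant. Any other class has a cut not
-- crossed in one direction; permutations fixing `f` then preserve both sides, so splitting the
-- class there changes neither side of the identity.
lemma signed_sum_hullBoard {n : ℕ} {w : Perm (Fin n)} (h4231 : AvoidsPattern w ![4, 2, 3, 1])
    (h35142 : AvoidsPattern w ![3, 5, 1, 4, 2]) (h42513 : AvoidsPattern w ![4, 2, 5, 1, 3])
    (h351624 : AvoidsPattern w ![3, 5, 1, 6, 2, 4]) (f : Fin n → ℕ) :
    ∑ p ∈ boardPerms (hullBoard w) with ∀ i, f (p i) = f i, (Perm.sign p : ℤ) =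
      if IsProper w f then 1 else 0 := by
  obtain ⟨N, hN⟩ : ∃ N, (Finset.univ.filter fun x : Fin n × Fin n => f x.1 = f x.2).card = N :=
    ⟨_, rfl⟩
  induction N using Nat.strong_induction_on generalizing f with
  | _ N ih =>
  by_cases hinj : Function.Injective f
  · have hfil : (boardPerms (hullBoard w)).filter (fun p => ∀ i, f (p i) = f i) = {1} := by
      ext p
      rw [Finset.mem_filter, mem_boardPerms, Finset.mem_singleton]
      constructor
      · rintro ⟨-, h⟩
        ext i
        rw [hinj (h i)]
        rfl
      · rintro rfl
        exact ⟨fun i => ⟨⟨i, le_rfl, le_rfl⟩, i, le_rfl, le_rfl⟩, fun i => rfl⟩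
    have hf : IsProper w f := fun i j hij _ e => hij.ne (hinj e)
    rw [hfil, if_pos hf]
    simp
  obtain ⟨i₀, j₀, he₀, hne₀⟩ : ∃ i j, f i = f j ∧ i ≠ j := by
    simpa [Function.Injective] using hinj
  set S := Finset.univ.filter fun i => f i = f i₀ with hSdef
  have hmem : ∀ i, i ∈ S ↔ f i = f i₀ := fun i => by simp [hSdef]
  clear_value S
  by_cases hS : HullConnected w S
  · have hcard : 1 < S.card := Finset.one_lt_card.2
      ⟨i₀, (hmem _).2 rfl, j₀, (hmem _).2 he₀.symm, hne₀⟩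
    have hnot : ¬ IsProper w f := by
      intro hf
      obtain ⟨i, hi, j, hj, hij, hw⟩ : ∃ i ∈ S, ∃ j ∈ S, i < j ∧ w j < w i := by
        rcases lt_or_gt_of_ne hne₀ with h | h
        · exact hS.exists_inversion h4231 ((hmem _).2 rfl) ((hmem _).2 he₀.symm) h
        · exact hS.exists_inversion h4231 ((hmem _).2 he₀.symm) ((hmem _).2 rfl) h
      exact hf i j hij hw (((hmem i).1 hi).trans ((hmem j).1 hj).symm)
    rw [signed_sum_eq_det, if_neg hnot]
    rcases hS.exists_eq h4231 h35142 h42513 h351624 hcard with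
      ⟨p, hp, q, hq, hpq, h⟩ | ⟨a, ha, b, hb, hab, h⟩
    · refine Matrix.det_zero_of_column_eq hpq fun l => ?_
      simp only [boardMatrix, Matrix.of_apply]
      rw [(hmem p).1 hp, (hmem q).1 hq]
      exact if_congr (and_congr_left fun e => h l ((hmem l).2 e)) rfl rfl
    · refine Matrix.det_zero_of_row_eq hab ?_
      ext l
      simp only [boardMatrix, Matrix.of_apply]
      rw [(hmem a).1 ha, (hmem b).1 hb]
      exact if_congr (and_congr_left fun e => h l ((hmem l).2 e.symm)) rfl rfl
  obtain ⟨m, ⟨s₀, hs₀, hs₀m⟩, ⟨z₀, hz₀, hz₀m⟩, hcut⟩ : ∃ m : ℕ, (∃ s ∈ S, (s : ℕ) < m) ∧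
      (∃ z ∈ S, m ≤ (z : ℕ)) ∧
      ((∀ s ∈ S, ∀ z ∈ S, (s : ℕ) < m → m ≤ (z : ℕ) → ¬ hullBoard w s z) ∨
        ∀ s ∈ S, ∀ z ∈ S, (s : ℕ) < m → m ≤ (z : ℕ) → ¬ hullBoard w z s) := by
    simp only [HullConnected] at hS
    push Not at hS
    obtain ⟨m, h1, h2, h3⟩ := hS
    refine ⟨m, h1, h2, ?_⟩
    by_cases hc : ∃ s ∈ S, ∃ z ∈ S, (s : ℕ) < m ∧ m ≤ (z : ℕ) ∧ hullBoard w s z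
    · exact Or.inr (h3 hc)
    · push Not at hc
      exact Or.inl hc
  -- Doubling the colours frees the odd colour `2 * f i₀ + 1` for the part of the class from `m` on.
  set f' : Fin n → ℕ := fun i => 2 * f i + if f i = f i₀ ∧ m ≤ (i : ℕ) then 1 else 0 with hf'
  have hf'f : ∀ i j, f' i = f' j → f i = f j := by
    intro i j h
    simp only [hf'] at h
    split_ifs at h <;> omega
  have hf'eq : ∀ i j, f i = f j → ((f i = f i₀ ∧ m ≤ (i : ℕ)) ↔ (f j = f i₀ ∧ m ≤ (j : ℕ))) →
      f' i = f' j := by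
    intro i j h h'
    simp only [hf', h] at h' ⊢
    simp only [h']
  have hlt : (Finset.univ.filter fun x : Fin n × Fin n => f' x.1 = f' x.2).card < N := by
    rw [← hN]
    refine Finset.card_lt_card (Finset.ssubset_iff_subset_ne.2 ⟨?_, ?_⟩)
    · intro x hx
      rw [Finset.mem_filter] at hx ⊢
      exact ⟨hx.1, hf'f _ _ hx.2⟩
    · intro e
      have : (s₀, z₀) ∈ Finset.univ.filter fun x : Fin n × Fin n => f x.1 = f x.2 := by
        rw [Finset.mem_filter]
        exact ⟨Finset.mem_univ _, ((hmem _).1 hs₀).trans ((hmem _).1 hz₀).symm⟩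
      rw [← e, Finset.mem_filter] at this
      have h' := this.2
      simp only [hf', (hmem _).1 hs₀, (hmem _).1 hz₀, true_and, if_pos hz₀m,
        if_neg (not_le.2 hs₀m)] at h'
      omega
  have hproper : IsProper w f ↔ IsProper w f' := by
    constructor
    · exact fun h i j hij hw e => h i j hij hw (hf'f i j e)
    · intro h i j hij hw e
      refine h i j hij hw (hf'eq i j e ?_)
      rw [e]
      refine and_congr_right fun hc => ⟨fun hi => hi.trans hij.le, fun hj => ?_⟩
      by_contra hi
      obtain ⟨h1, h2⟩ := hullBoard_of_inversion hij hw
      have hiS := (hmem i).2 (e.trans hc)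
      have hjS := (hmem j).2 hc
      rcases hcut with hcut | hcut
      · exact hcut i hiS j hjS (not_le.1 hi) hj h1
      · exact hcut i hiS j hjS (not_le.1 hi) hj h2
  have hfil : (boardPerms (hullBoard w)).filter (fun p => ∀ i, f (p i) = f i) =
      (boardPerms (hullBoard w)).filter fun p => ∀ i, f' (p i) = f' i := by
    refine Finset.filter_congr fun p hp => ⟨fun h i => ?_, fun h i => hf'f _ _ (h i)⟩
    refine hf'eq _ _ (h i) ?_
    rw [h i]
    refine and_congr_right fun hc => ?_
    have hp := mem_boardPerms.1 hp
    rcases hcut with hcut | hcut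
    · have hT := perm_apply_mem_iff (p := p) (T := S.filter fun i => (i : ℕ) < m) (by
        intro i hi
        rw [Finset.mem_filter] at hi ⊢
        have hpi : p i ∈ S := (hmem _).2 ((h i).trans ((hmem _).1 hi.1))
        refine ⟨hpi, ?_⟩
        by_contra hc
        exact hcut i hi.1 _ hpi hi.2 (not_lt.1 hc) (hp i)) i
      rw [Finset.mem_filter, Finset.mem_filter, hmem, hmem, h i] at hT
      simp only [hc, true_and] at hT
      omega
    · have hT := perm_apply_mem_iff (p := p) (T := S.filter fun i => m ≤ (i : ℕ)) (by
        intro i hi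
        rw [Finset.mem_filter] at hi ⊢
        have hpi : p i ∈ S := (hmem _).2 ((h i).trans ((hmem _).1 hi.1))
        refine ⟨hpi, ?_⟩
        by_contra hc
        exact hcut _ hpi i hi.1 (not_le.1 hc) hi.2 (hp i)) i
      rw [Finset.mem_filter, Finset.mem_filter, hmem, hmem, h i] at hT
      simpa only [hc, true_and] using hT
  rw [hfil, ih _ hlt f' rfl, if_congr hproper rfl rfl]

/-! ### Comparison with the Bruhat interval -/

lemma ncard_bruhatInterval {n : ℕ} (w : Perm (Fin n)) :
    (bruhatInterval 1 w).ncard = {p : Perm (Fin n) | BruhatLE (w * p) w}.ncard := by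
  rw [← Set.ncard_image_of_injective {p : Perm (Fin n) | BruhatLE (w * p) w}
    (mul_right_injective w)]
  congr 1
  ext u
  constructor
  · rintro ⟨-, h⟩
    exact ⟨w⁻¹ * u, by simpa using h, by simp⟩
  · rintro ⟨p, hp, rfl⟩
    exact ⟨one_bruhatLE _, hp⟩

/-- Successive transpositions of the word `pat ∘ τ`, each of which removes an inversion. -/
def descends {k : ℕ} (pat : Fin k → ℕ) : Perm (Fin k) → List (Fin k × Fin k) → Bool
  | _, [] => true
  | τ, (a, b) :: l =>
    decide (a < b) && decide (pat (τ b) < pat (τ a)) && descends pat (τ * swap a b) l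

/-- The product of a list of transpositions. -/
def swapProd {k : ℕ} (l : List (Fin k × Fin k)) : Perm (Fin k) :=
  (l.map fun e => swap e.1 e.2).prod

lemma viaEmbeddingHom_swap {k n : ℕ} (F : Fin k ↪ Fin n) (a b : Fin k) :
    Perm.viaEmbeddingHom F (swap a b) = swap (F a) (F b) := by
  ext x
  rw [Perm.viaEmbeddingHom_apply]
  by_cases hx : x ∈ Set.range F
  · obtain ⟨y, rfl⟩ := hx
    rw [Perm.viaEmbedding_apply, F.injective.swap_apply]
  · rw [Perm.viaEmbedding_apply_of_notMem _ _ _ hx, swap_apply_of_ne_of_ne]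
    · rintro rfl; exact hx ⟨a, rfl⟩
    · rintro rfl; exact hx ⟨b, rfl⟩

/-- Along `F`, values of `w` compare like letters of the pattern, so each inversion removed from the
pattern is also removed from `w`. -/
lemma bruhatLE_of_descends {n k : ℕ} {w : Perm (Fin n)} {pat : Fin k → ℕ} (F : Fin k ↪ Fin n)
    (hF : StrictMono F) (hpat : ∀ a b, w (F a) < w (F b) ↔ pat a < pat b)
    (l : List (Fin k × Fin k)) (τ : Perm (Fin k)) (hl : descends pat τ l = true) :
    BruhatLE (w * Perm.viaEmbeddingHom F (τ * swapProd l)) (w * Perm.viaEmbeddingHom F τ) := by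
  induction l generalizing τ with
  | nil =>
    simp only [swapProd, List.map_nil, List.prod_nil, mul_one]
    exact Relation.ReflTransGen.refl
  | cons e l ih =>
    obtain ⟨a, b⟩ := e
    simp only [descends, Bool.and_eq_true, decide_eq_true_eq] at hl
    obtain ⟨⟨hab, hlt⟩, hl⟩ := hl
    have h1 := ih (τ * swap a b) hl
    have h2 : BruhatLE (w * Perm.viaEmbeddingHom F τ * swap (F a) (F b))
        (w * Perm.viaEmbeddingHom F τ) := by
      refine BruhatLE.mul_swap_le _ (hF hab) ?_
      simp only [Perm.mul_apply, Perm.viaEmbeddingHom_apply, Perm.viaEmbedding_apply]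
      exact (hpat _ _).2 hlt
    have e1 : τ * swap a b * swapProd l = τ * swapProd ((a, b) :: l) := by
      simp [swapProd, mul_assoc]
    rw [e1] at h1
    refine h1.trans ?_
    rwa [map_mul, viaEmbeddingHom_swap, ← mul_assoc]

lemma card_nbc_perms {n : ℕ} {w : Perm (Fin n)} {Φ : Finset (Perm (Fin n))}
    (hΦ : ∀ f : Fin n → ℕ, ∑ p ∈ Φ with ∀ i, f (p i) = f i, (Perm.sign p : ℤ) =
      open Classical in if IsProper w f then 1 else 0) :
    rookPlacementsAvoiding (swDiagram w) = Φ.card := by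
  rw [rookPlacementsAvoiding_swDiagram]
  refine card_eq_of_signed_sums _ _ fun f => ?_
  rw [hΦ, signed_sum_eq_det, det_inversionBoard]

/-- If `w` contains a pattern below which, in the Bruhat order, there is a permutation whose
quotient by the pattern has a cycle that is disconnected in the inversion graph, then the rook count
differs from the size of the Bruhat interval. -/
lemma rookPlacementsAvoiding_ne_of_containsPattern {n k : ℕ} {w : Perm (Fin n)} {pat : Fin k → ℕ}
    (hc : ContainsPattern w pat) (l : List (Fin k × Fin k)) (hl : descends pat 1 l = true)
    (φ γ : Fin k → ℕ) (hφ : ∀ a, φ (swapProd l a) = φ a)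
    (hγ : ∀ a b, a < b → pat b < pat a → φ a = φ b → γ a = γ b)
    (hne : ¬ ∀ a, γ (swapProd l a) = γ a) :
    rookPlacementsAvoiding (swDiagram w) ≠ (bruhatInterval 1 w).ncard := by
  intro heq
  obtain ⟨Φ, hΦ1, hΦ2, hΦ3⟩ := exists_nbc_perms w
  rw [card_nbc_perms hΦ2, ncard_bruhatInterval, ← Set.ncard_coe_finset] at heq
  -- Equal sizes force `Φ` to be the whole interval, so it contains the copy of `swapProd l`.
  have hset : (Φ : Set (Perm (Fin n))) = {p | BruhatLE (w * p) w} :=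
    Set.eq_of_subset_of_ncard_le (fun p hp => hΦ1 p hp) heq.ge
  obtain ⟨F, hF, hpat⟩ := hc
  let ι : Fin k ↪ Fin n := ⟨F, hF.injective⟩
  have hmem : Perm.viaEmbeddingHom ι (swapProd l) ∈ Φ := by
    have := bruhatLE_of_descends ι hF hpat l 1 hl
    rw [one_mul, map_one, mul_one] at this
    rw [← Finset.mem_coe, hset]
    exact this
  have hext : ∀ (g : Fin k → ℕ) (a : Fin k), Function.extend F g 0 (F a) = g a := fun g a =>
    hF.injective.extend_apply _ _ _
  have hext' : ∀ (g : Fin k → ℕ) (x : Fin n), x ∉ Set.range F → Function.extend F g 0 x = 0 :=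
    fun g x hx => Function.extend_apply' _ _ _ hx
  refine hne fun a => ?_
  -- The shift by one reserves colour `0` for the positions outside the pattern.
  have := hΦ3 _ hmem (Function.extend F (fun a => φ a + 1) 0) (Function.extend F γ 0) ?_ ?_ (F a)
  · rw [Perm.viaEmbeddingHom_apply, show F a = ι a from rfl, Perm.viaEmbedding_apply] at this
    simpa [ι, hext] using this
  · intro x
    rw [Perm.viaEmbeddingHom_apply]
    by_cases hx : x ∈ Set.range F
    · obtain ⟨a, rfl⟩ := hx
      rw [show F a = ι a from rfl, Perm.viaEmbedding_apply]
      simp [ι, hext, hφ]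
    · rw [Perm.viaEmbedding_apply_of_notMem _ _ _ hx]
  · intro x y hxy hw hf
    by_cases hx : x ∈ Set.range F <;> by_cases hy : y ∈ Set.range F
    · obtain ⟨a, rfl⟩ := hx
      obtain ⟨b, rfl⟩ := hy
      rw [hext, hext] at hf ⊢
      exact hγ a b (hF.lt_iff_lt.1 hxy) ((hpat _ _).1 hw) (by omega)
    · obtain ⟨a, rfl⟩ := hx
      rw [hext, hext' _ _ hy] at hf
      omega
    · obtain ⟨b, rfl⟩ := hy
      rw [hext, hext' _ _ hx] at hf
      omega
    · rw [hext' _ _ hx, hext' _ _ hy]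

lemma rookPlacementsAvoiding_eq_of_avoids {n : ℕ} {w : Perm (Fin n)}
    (h4231 : AvoidsPattern w ![4, 2, 3, 1]) (h35142 : AvoidsPattern w ![3, 5, 1, 4, 2])
    (h42513 : AvoidsPattern w ![4, 2, 5, 1, 3])
    (h351624 : AvoidsPattern w ![3, 5, 1, 6, 2, 4]) :
    rookPlacementsAvoiding (swDiagram w) = (bruhatInterval 1 w).ncard := by
  rw [ncard_bruhatInterval]
  apply le_antisymm
  · obtain ⟨Φ, hΦ1, hΦ2, -⟩ := exists_nbc_perms w
    rw [card_nbc_perms hΦ2, ← Set.ncard_coe_finset]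
    exact Set.ncard_le_ncard fun p hp => hΦ1 p hp
  -- `card_nbc_perms` needs only the signed counts, so it applies to the hull board as well.
  · rw [card_nbc_perms (signed_sum_hullBoard h4231 h35142 h42513 h351624), ← Set.ncard_coe_finset]
    refine Set.ncard_le_ncard fun p hp => ?_
    have := mem_boardPerms_hullBoard hp
    rwa [inv_mul_cancel_left] at this

end RookBruhat

theorem mainTheorem3 (n : ℕ) (w : Equiv.Perm (Fin n)) :
    RookBruhat.rookPlacementsAvoiding (RookBruhat.swDiagram w) =
        (RookBruhat.bruhatInterval 1 w).ncard ↔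
      RookBruhat.AvoidsPattern w ![4, 2, 3, 1] ∧
      RookBruhat.AvoidsPattern w ![3, 5, 1, 4, 2] ∧
      RookBruhat.AvoidsPattern w ![4, 2, 5, 1, 3] ∧
      RookBruhat.AvoidsPattern w ![3, 5, 1, 6, 2, 4] := by
  refine ⟨fun h => ⟨fun hc => ?_, fun hc => ?_, fun hc => ?_, fun hc => ?_⟩,
    fun ⟨h1, h2, h3, h4⟩ => RookBruhat.rookPlacementsAvoiding_eq_of_avoids h1 h2 h3 h4⟩
  -- In all four cases `φ` labels the cycles of the product of the list, and `γ` splits one of them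
  -- into parts not joined by inversions. For 4231 the product is `(0 3)(1 2)`, and the letters 2, 3
  -- at positions 1, 2 are not inverted.
  · exact RookBruhat.rookPlacementsAvoiding_ne_of_containsPattern hc
      [(0, 1), (0, 3), (1, 2), (2, 3)] (by decide) ![0, 1, 1, 0] ![0, 0, 1, 0]
      (by decide) (by decide) (by decide) h
  · exact RookBruhat.rookPlacementsAvoiding_ne_of_containsPattern hc
      [(0, 2), (1, 2), (1, 4), (2, 3), (3, 4)] (by decide) ![0, 1, 0, 0, 1] ![0, 0, 0, 1, 0]
      (by decide) (by decide) (by decide) h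
  · exact RookBruhat.rookPlacementsAvoiding_ne_of_containsPattern hc
      [(0, 1), (0, 3), (1, 4), (2, 3), (3, 4)] (by decide) ![0, 1, 1, 0, 1] ![0, 1, 0, 0, 0]
      (by decide) (by decide) (by decide) h
  · exact RookBruhat.rookPlacementsAvoiding_ne_of_containsPattern hc
      [(0, 2), (1, 2), (1, 4), (2, 5), (3, 4), (4, 5)] (by decide) ![0, 1, 0, 0, 1, 0]
      ![0, 0, 0, 1, 0, 1] (by decide) (by decide) (by decide) h
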